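/- For $j\in\{1,2\}$ let $(M_j,\omega_j)$ be a compact connected Kähler manifold of complex dimension $d_j\ge 1$, and let $(L_j,h_j)$ be a very ample holomorphic Hermitian line bundle on $M_j$ whose Chern connection has curvature $-i\omega_j$. Equip $\mathcal H_A=H^0(M_1,L_1)$ and $\mathcal H_B=H^0(M_2,L_2)$ with the inner products $\langle s,t\rangle_j=\int_{M_j}h_j(s,t)\,d\mu_j$, where $\mu_j$ is the measure of the volume form $\omega_j^{d_j}/d_j!$, and equip $\mathcal H_A\otimes\mathcal H_B$ with the induced tensor product inner product. Let $L_1\boxtimes L_2\to M_1\times M_2$ be the external tensor product, with fibre $(L_1)_x\otimes(L_2)_y$ at $(x,y)$. For a subset $\Lambda$ of $M_1$, $M_2$ or $M_1\times M_2$, let $\mathcal R_\Lambda$ be the linear map that restricts global holomorphic sections of $L_1$, $L_2$ or $L_1\boxtimes L_2$, respectively, to (set-theoretic) sections over $\Lambda$. The canonical map $\mathcal H_A\otimes\mathcal H_B\to H^0(M_1\times M_2,L_1\boxtimes L_2)$, $s\otimes t\mapsto\big((x,y)\mapsto s(x)\otimes t(y)\big)$, is a linear isomorphism, by which the two spaces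 are identified. With this identification, for all non-empty subsets $\Lambda_1\subset M_1$ and $\Lambda_2\subset M_2$, $$\ker(\mathcal R_{\Lambda_1\times\Lambda_2})=\big[\mathcal H_A\otimes\ker(\mathcal R_{\Lambda_2})\big]\oplus\big[\ker(\mathcal R_{\Lambda_1})\otimes\ker(\mathcal R_{\Lambda_2})^{\perp}\big],$$ where the direct sum is orthogonal, and consequently $$\ker(\mathcal R_{\Lambda_1\times\Lambda_2})^{\perp}=\ker(\mathcal R_{\Lambda_1})^{\perp}\otimes\ker(\mathcal R_{\Lambda_2})^{\perp}.$$ -/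

import Mathlib

open scoped Manifold ContDiff Bundle TensorProduct ComplexConjugate InnerProductSpace
open MeasureTheory Bundle

noncomputable section

namespace KahlerQuantization

/-- The coordinate space `ℂ^d` on which complex manifolds of dimension `d` are modelled. -/
abbrev Cn (d : ℕ) : Type := Fin d → ℂ

section KahlerForms

variable {d : ℕ} {M : Type*} [TopologicalSpace M] [ChartedSpace (Cn d) M]

/-- The expression of a real 2-form `η` on `M` in the preferred chart at `x`, i.e. the pullback of
`η` along the inverse of that chart. It is meaningful on the target of the chart. -/
def chartForm (η : ∀ x : M, TangentSpace 𝓘(ℝ, Cn d) x [⋀^Fin 2]→L[ℝ] ℝ) (x : M) (z : Cn d) :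
    Cn d [⋀^Fin 2]→L[ℝ] ℝ :=
  (η ((chartAt (Cn d) x).symm z)).compContinuousLinearMap
    (mfderiv 𝓘(ℝ, Cn d) 𝓘(ℝ, Cn d) (chartAt (Cn d) x).symm z)

variable (d M) in
/-- A Kähler form on a complex manifold: a smooth closed real 2-form which is of type `(1,1)`
(invariant under multiplication by `i`) and positive. As the charts are holomorphic, all four
conditions may be expressed in the charts. -/
structure KahlerForm where
  /-- the 2-form -/
  form : ∀ x : M, TangentSpace 𝓘(ℝ, Cn d) x [⋀^Fin 2]→L[ℝ] ℝ
  smooth : ∀ x : M, ContDiffOn ℝ ∞ (chartForm form x) (chartAt (Cn d) x).target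
  closed : ∀ x : M, ∀ z ∈ (chartAt (Cn d) x).target, extDeriv (chartForm form x) z = 0
  map_I : ∀ x : M, ∀ z ∈ (chartAt (Cn d) x).target, ∀ u v : Cn d,
    chartForm form x z ![Complex.I • u, Complex.I • v] = chartForm form x z ![u, v]
  pos : ∀ x : M, ∀ z ∈ (chartAt (Cn d) x).target, ∀ u : Cn d, u ≠ 0 →
    0 < chartForm form x z ![u, Complex.I • u]

namespace KahlerForm

/-- The matrix, in the chart at `x`, of the Hermitian form `ω(u, iv) - i ω(u, v)`
associated with the Kähler form `ω`. If `ω = i ∑ g_{jk} dz_j ∧ dz̄_k` this is `2 g`. -/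
def hermMatrix (K : KahlerForm d M) (x : M) (z : Cn d) : Matrix (Fin d) (Fin d) ℂ :=
  Matrix.of fun j k =>
    (chartForm K.form x z ![Pi.single j 1, Complex.I • Pi.single k 1] : ℂ) -
      Complex.I * (chartForm K.form x z ![Pi.single j 1, Pi.single k 1] : ℂ)

/-- The density of the volume form `ω^d / d!` with respect to Lebesgue measure in the chart at `x`.
For `ω = (i/2) ∑ h_{jk} dz_j ∧ dz̄_k` one has
`ω^d / d! = det h · dx_1 ∧ dy_1 ∧ ⋯ ∧ dx_d ∧ dy_d`. -/
def density (K : KahlerForm d M) (x : M) (z : Cn d) : ℝ := (K.hermMatrix x z).det.re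

variable [MeasurableSpace M]

/-- The measure of the volume form `ω^d / d!` on the source of the chart at `x`. -/
def localVolume (K : KahlerForm d M) (x : M) : Measure M :=
  (((volume : Measure (Cn d)).withDensity fun z => ENNReal.ofReal (K.density x z)).restrict
    (chartAt (Cn d) x).target).map (chartAt (Cn d) x).symm

end KahlerForm

variable (d) in
/-- A coordinate ball. -/
def coordBall (x : M) (r : ℝ) : Set M :=
  (chartAt (Cn d) x).source ∩ chartAt (Cn d) x ⁻¹' Metric.ball (chartAt (Cn d) x x) r

variable (d M) in
/-- A finite covering of `M` by relatively compact coordinate balls. -/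
structure BallCover where
  n : ℕ
  center : Fin n → M
  radius : Fin n → ℝ
  closedBall_subset : ∀ i, Metric.closedBall (chartAt (Cn d) (center i) (center i)) (radius i) ⊆
    (chartAt (Cn d) (center i)).target
  cover : ∀ x : M, ∃ i, x ∈ coordBall d (center i) (radius i)

theorem isOpen_coordBall (x : M) (r : ℝ) : IsOpen (coordBall d x r) :=
  (chartAt (Cn d) x).continuousOn.isOpen_inter_preimage (chartAt (Cn d) x).open_source
    Metric.isOpen_ball

variable (d M) in
theorem nonempty_ballCover [CompactSpace M] : Nonempty (BallCover d M) := by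
  have h : ∀ x : M, ∃ r : ℝ, 0 < r ∧
      Metric.closedBall (chartAt (Cn d) x x) r ⊆ (chartAt (Cn d) x).target := fun x =>
    Metric.nhds_basis_closedBall.mem_iff.1
      ((chartAt (Cn d) x).open_target.mem_nhds (mem_chart_target _ x))
  choose r hr hsub using h
  obtain ⟨t, ht⟩ := isCompact_univ.elim_finite_subcover (fun x : M => coordBall d x (r x))
    (fun x => isOpen_coordBall x (r x))
    (fun x _ => Set.mem_iUnion.2 ⟨x, mem_chart_source _ x, Metric.mem_ball_self (hr x)⟩)
  refine ⟨⟨t.card, fun i => (t.equivFin.symm i : M), fun i => r (t.equivFin.symm i : M),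
    fun i => hsub _, fun x => ?_⟩⟩
  have hx := ht (Set.mem_univ x)
  simp only [Set.mem_iUnion] at hx
  obtain ⟨y, hy, hxy⟩ := hx
  exact ⟨t.equivFin ⟨y, hy⟩, by simpa using hxy⟩

/-- The disjoint pieces `B_i \ (B_0 ∪ ⋯ ∪ B_{i-1})` of a ball cover. -/
def BallCover.piece (C : BallCover d M) (i : Fin C.n) : Set M :=
  coordBall d (C.center i) (C.radius i) \ ⋃ j : Fin C.n, ⋃ _ : j < i,
    coordBall d (C.center j) (C.radius j)

namespace KahlerForm

theorem continuousOn_hermMatrix (K : KahlerForm d M) (x : M) :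
    ContinuousOn (K.hermMatrix x) (chartAt (Cn d) x).target := by
  have h := (K.smooth x).continuousOn
  have key : ∀ m : Fin 2 → Cn d,
      ContinuousOn (fun z => chartForm K.form x z m) (chartAt (Cn d) x).target := fun m =>
    (ContinuousAlternatingMap.apply ℝ (Cn d) ℝ m).continuous.comp_continuousOn h
  refine continuousOn_pi.2 fun j => continuousOn_pi.2 fun k => ?_
  exact (Complex.continuous_ofReal.comp_continuousOn (key _)).sub
    (continuousOn_const.mul (Complex.continuous_ofReal.comp_continuousOn (key _)))

theorem continuousOn_density (K : KahlerForm d M) (x : M) :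
    ContinuousOn (K.density x) (chartAt (Cn d) x).target :=
  Complex.continuous_re.comp_continuousOn
    ((continuous_id.matrix_det).comp_continuousOn (K.continuousOn_hermMatrix x))

open scoped ComplexOrder in
theorem density_pos (K : KahlerForm d M) (x : M) {z : Cn d}
    (hz : z ∈ (chartAt (Cn d) x).target) : 0 < K.density x z := by
  set a := chartForm K.form x z with ha
  have hI : ∀ u v : Cn d, a ![Complex.I • u, Complex.I • v] = a ![u, v] := K.map_I x z hz
  have addl : ∀ u u' v : Cn d, a ![u + u', v] = a ![u, v] + a ![u', v] := fun u u' v =>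
    a.toAlternatingMap.map_vecCons_add ![v] u u'
  have smull : ∀ (c : ℝ) (u v : Cn d), a ![c • u, v] = c * a ![u, v] := fun c u v =>
    a.toAlternatingMap.map_vecCons_smul ![v] c u
  have swap : ∀ u v : Cn d, a ![v, u] = - a ![u, v] := fun u v => by
    have := a.toAlternatingMap.map_swap ![u, v] (i := 0) (j := 1) (by decide)
    rw [← show (![u, v] ∘ Equiv.swap 0 1 : Fin 2 → Cn d) = ![v, u] by
      ext i; fin_cases i <;> simp]
    exact this
  have addr : ∀ u v v' : Cn d, a ![u, v + v'] = a ![u, v] + a ![u, v'] := fun u v v' => by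
    rw [swap, addl, swap u v, swap u v']; ring
  have smulr : ∀ (c : ℝ) (u v : Cn d), a ![u, c • v] = c * a ![u, v] := fun c u v => by
    rw [swap, smull, swap u v]; ring
  have II : ∀ u : Cn d, Complex.I • Complex.I • u = (-1 : ℝ) • u := fun u => by
    rw [smul_smul, Complex.I_mul_I]; simp
  have hIl : ∀ u v : Cn d, a ![Complex.I • u, v] = - a ![u, Complex.I • v] := fun u v => by
    rw [← hI (Complex.I • u) v, II, smull]; ring
  have cs : ∀ (c : ℂ) (u : Cn d), c • u = c.re • u + c.im • (Complex.I • u) := fun c u => by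
    conv_lhs => rw [← Complex.re_add_im c, add_smul, mul_smul]
    simp
  let B : Cn d →ₗ[ℂ] Cn d →ₗ⋆[ℂ] ℂ := LinearMap.mk₂'ₛₗ (RingHom.id ℂ) (starRingEnd ℂ)
    (fun u v => (a ![u, Complex.I • v] : ℂ) - Complex.I * (a ![u, v] : ℂ))
    (fun u u' v => by simp only [addl]; push_cast; ring)
    (fun c u v => by
      rw [cs c u, addl, addl, smull, smull, smull, smull, hI, hIl]
      apply Complex.ext <;> simp
      ring)
    (fun u v v' => by simp only [smul_add, addr]; push_cast; ring)
    (fun c u v => by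
      rw [cs c v, smul_add, smul_comm Complex.I c.re, smul_comm Complex.I c.im, II, addr, addr,
        smulr, smulr, smulr, smulr, smulr]
      apply Complex.ext <;> simp <;> ring)
  have hB : ∀ u v, B u v = (a ![u, Complex.I • v] : ℂ) - Complex.I * (a ![u, v] : ℂ) :=
    fun u v => rfl
  have hM : ∀ j k, K.hermMatrix x z j k = B (Pi.single j 1) (Pi.single k 1) := fun j k => rfl
  have hBs : ∀ u v, star (B u v) = B v u := fun u v => by
    rw [hB, hB, swap u v, swap (Complex.I • u) v, hIl]
    apply Complex.ext <;> simp
  have hBx : ∀ c : Cn d, star c ⬝ᵥ (K.hermMatrix x z).mulVec c = B (star c) (star c) := fun c => by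
    conv_rhs => rw [pi_eq_sum_univ' (star c)]
    simp only [map_sum, LinearMap.sum_apply, map_smul, map_smulₛₗ, LinearMap.smul_apply, hM,
      dotProduct, Matrix.mulVec, smul_eq_mul, Finset.mul_sum]
    rw [Finset.sum_comm]
    refine Finset.sum_congr rfl fun j _ => Finset.sum_congr rfl fun k _ => ?_
    simp only [Pi.star_apply, RCLike.star_def, Complex.conj_conj]
    ring
  have hpd : (K.hermMatrix x z).PosDef := by
    rw [Matrix.posDef_iff_dotProduct_mulVec]
    refine ⟨?_, fun c hc => ?_⟩
    · ext j k
      rw [Matrix.conjTranspose_apply, hM, hM, hBs]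
    · rw [hBx, hB]
      have h0 : a ![star c, star c] = 0 := by have := swap (star c) (star c); linarith
      have hp : 0 < a ![star c, Complex.I • star c] := K.pos x z hz _ (by simpa using hc)
      rw [h0]
      simpa using hp
  exact (Complex.pos_iff.1 hpd.det_pos).1

variable [MeasurableSpace M]

/-- The measure on the compact manifold `M` associated with the volume form `ω^d / d!`, glued from
its expressions in charts along a finite measurable partition of `M` subordinate to charts. By the
change of variables formula these expressions agree on overlaps, so that the result does not depend
on the partition. -/
def volumeMeasure [CompactSpace M] (K : KahlerForm d M) : Measure M :=
  let C : BallCover d M := Classical.choice (nonempty_ballCover d M)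
  ∑ i : Fin C.n, (K.localVolume (C.center i)).restrict (C.piece i)

theorem localVolume_apply [BorelSpace M] (K : KahlerForm d M) (x : M) {s : Set M}
    (hs : MeasurableSet s) : K.localVolume x s =
      ∫⁻ z in (chartAt (Cn d) x).symm ⁻¹' s ∩ (chartAt (Cn d) x).target,
        ENNReal.ofReal (K.density x z) := by
  have ht := (chartAt (Cn d) x).open_target.measurableSet
  have hm : AEMeasurable (chartAt (Cn d) x).symm (((volume : Measure (Cn d)).withDensity
      fun z => ENNReal.ofReal (K.density x z)).restrict (chartAt (Cn d) x).target) :=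
    (chartAt (Cn d) x).continuousOn_symm.aemeasurable ht
  have hms : MeasurableSet ((chartAt (Cn d) x).symm ⁻¹' s ∩ (chartAt (Cn d) x).target) := by
    have := (measurable_of_isOpen (f := fun z : (chartAt (Cn d) x).target =>
      (chartAt (Cn d) x).symm z) fun t ht' =>
        ((continuousOn_iff_continuous_domRestrict.1
          (chartAt (Cn d) x).continuousOn_symm).isOpen_preimage t ht').measurableSet) hs
    have h2 := (MeasurableEmbedding.subtype_coe ht).measurableSet_image.2 this
    convert h2 using 1
    ext z
    simp [and_comm]
  rw [localVolume, Measure.map_apply_of_aemeasurable hm hs, Measure.restrict_apply₀' ht.nullMeasurableSet,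
    withDensity_apply _ hms]

instance [CompactSpace M] [BorelSpace M] (K : KahlerForm d M) :
    IsFiniteMeasure K.volumeMeasure := by
  refine ⟨?_⟩
  simp only [volumeMeasure, Measure.coe_finsetSum, Finset.sum_apply]
  set C : BallCover d M := Classical.choice (nonempty_ballCover d M)
  refine ENNReal.sum_lt_top.2 fun i _ => ?_
  rw [Measure.restrict_apply MeasurableSet.univ, Set.univ_inter]
  refine (measure_mono (μ := K.localVolume (C.center i))
    (t := coordBall d (C.center i) (C.radius i)) Set.sdiff_subset).trans_lt ?_
  rw [localVolume_apply _ _ (isOpen_coordBall _ _).measurableSet]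
  set φ := chartAt (Cn d) (C.center i)
  have hc := isCompact_closedBall (φ (C.center i)) (C.radius i)
  have hsub : φ.symm ⁻¹' coordBall d (C.center i) (C.radius i) ∩ φ.target ⊆
      Metric.closedBall (φ (C.center i)) (C.radius i) := by
    rintro z ⟨hz, hzt⟩
    have := hz.2
    rw [Set.mem_preimage, φ.right_inv hzt] at this
    exact Metric.ball_subset_closedBall this
  refine (lintegral_mono_set hsub).trans_lt ?_
  obtain ⟨B, hB⟩ := (hc.image_of_continuousOn
    ((K.continuousOn_density (C.center i)).mono (C.closedBall_subset i))).bddAbove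
  refine (setLIntegral_mono (g := fun _ => ENNReal.ofReal B) measurable_const fun z hz =>
    ENNReal.ofReal_le_ofReal (hB ⟨z, hz, rfl⟩)).trans_lt ?_
  rw [setLIntegral_const]
  exact ENNReal.mul_lt_top ENNReal.ofReal_lt_top hc.measure_lt_top

instance [CompactSpace M] [BorelSpace M] (K : KahlerForm d M) :
    K.volumeMeasure.IsOpenPosMeasure := by
  refine ⟨fun U hU hne hzero => ?_⟩
  simp only [volumeMeasure, Measure.coe_finsetSum, Finset.sum_apply, Finset.sum_eq_zero_iff,
    Finset.mem_univ, true_implies] at hzero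
  set C : BallCover d M := Classical.choice (nonempty_ballCover d M)
  obtain ⟨x, hx⟩ := hne
  obtain ⟨i₀, hi₀⟩ := C.cover x
  classical
  let S : Finset (Fin C.n) := Finset.univ.filter fun i =>
    (U ∩ coordBall d (C.center i) (C.radius i)).Nonempty
  have hS : S.Nonempty := ⟨i₀, by simpa [S] using ⟨x, hx, hi₀⟩⟩
  set i := S.min' hS
  have hi : (U ∩ coordBall d (C.center i) (C.radius i)).Nonempty := by
    simpa [S] using S.min'_mem hS
  have hmin : ∀ j < i, ¬ (U ∩ coordBall d (C.center j) (C.radius j)).Nonempty := fun j hj h =>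
    absurd (S.min'_le j (by simpa [S] using h)) (not_le.2 hj)
  have hsub : U ∩ coordBall d (C.center i) (C.radius i) ⊆ U ∩ C.piece i := by
    rintro y ⟨hyU, hy⟩
    refine ⟨hyU, hy, ?_⟩
    simp only [Set.mem_iUnion, not_exists]
    exact fun j hj hyj => hmin j hj ⟨y, hyU, hyj⟩
  have h1 := hzero i
  rw [Measure.restrict_apply hU.measurableSet] at h1
  have hO : IsOpen (U ∩ coordBall d (C.center i) (C.radius i)) := hU.inter (isOpen_coordBall _ _)
  have h2 := measure_mono_null hsub h1
  rw [localVolume_apply _ _ hO.measurableSet, Set.inter_comm] at h2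
  set φ := chartAt (Cn d) (C.center i)
  have hV : IsOpen (φ.target ∩ φ.symm ⁻¹' (U ∩ coordBall d (C.center i) (C.radius i))) :=
    φ.symm.isOpen_inter_preimage hO
  obtain ⟨y, hyU, hy⟩ := hi
  have hVne : (φ.target ∩ φ.symm ⁻¹' (U ∩ coordBall d (C.center i) (C.radius i))).Nonempty :=
    ⟨φ y, φ.map_source hy.1, by rw [Set.mem_preimage, φ.left_inv hy.1]; exact ⟨hyU, hy⟩⟩
  have hae : AEMeasurable (fun z => ENNReal.ofReal (K.density (C.center i) z)) (volume.restrict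
      (φ.target ∩ φ.symm ⁻¹' (U ∩ coordBall d (C.center i) (C.radius i)))) :=
    (((K.continuousOn_density (C.center i)).mono Set.inter_subset_left).aemeasurable
      hV.measurableSet).ennreal_ofReal
  rw [lintegral_eq_zero_iff' hae, Filter.EventuallyEq, ae_restrict_iff' hV.measurableSet] at h2
  obtain ⟨z, hz, h⟩ : ∃ z ∈ φ.target ∩ φ.symm ⁻¹' (U ∩ coordBall d (C.center i) (C.radius i)),
      ENNReal.ofReal (K.density (C.center i) z) = 0 := by
    by_contra hcon
    push Not at hcon
    refine (hV.measure_pos volume hVne).ne' ?_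
    rw [measure_eq_zero_iff_ae_notMem]
    filter_upwards [h2] with z hz hzV using hcon z hzV (hz hzV)
  have := h
  rw [ENNReal.ofReal_eq_zero] at this
  exact absurd (K.density_pos (C.center i) hz.1) (not_lt.2 this)

end KahlerForm

end KahlerForms

section LineBundles

variable {d : ℕ} {M : Type*} [TopologicalSpace M] [ChartedSpace (Cn d) M]
  (L : M → Type*) [TopologicalSpace (TotalSpace ℂ L)] [∀ x, TopologicalSpace (L x)]
  [∀ x, AddCommGroup (L x)] [∀ x, Module ℂ (L x)] [FiberBundle ℂ L] [VectorBundle ℂ ℂ L]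

/-- The local frame of the line bundle `L` given by its preferred trivialization around `x₀`. -/
def frame (x₀ x : M) : L x := (trivializationAt ℂ L x₀).symm x 1

variable (d) in
/-- A smooth Hermitian metric on a holomorphic line bundle (conjugate linear in the first
variable). -/
structure HermitianMetric where
  inner : ∀ x : M, L x →ₗ⋆[ℂ] L x →ₗ[ℂ] ℂ
  conj_symm : ∀ (x : M) (u v : L x), conj (inner x v u) = inner x u v
  pos : ∀ (x : M) (u : L x), u ≠ 0 → 0 < (inner x u u).re
  smooth : ∀ x₀ : M, ContMDiffOn 𝓘(ℝ, Cn d) 𝓘(ℝ, ℝ) ∞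
    (fun x => (inner x (frame L x₀ x) (frame L x₀ x)).re) (trivializationAt ℂ L x₀).baseSet

/-- The value of the 2-form `∂∂̄ f` on the vectors `u`, `v`, at the point `z`. -/
def delDelbar (f : Cn d → ℝ) (z u v : Cn d) : ℂ :=
  Complex.I / 2 * ((iteratedFDeriv ℝ 2 f z ![u, Complex.I • v] -
    iteratedFDeriv ℝ 2 f z ![Complex.I • u, v] : ℝ) : ℂ)

variable {L}

/-- The curvature 2-form `∂̄∂ log h(σ, σ)` of the Chern connection, expressed in the chart at `x`,
where `σ` is the holomorphic frame of `L` around `x₀`. -/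
def HermitianMetric.chernCurvature (h : HermitianMetric d L) (x₀ x : M) (z u v : Cn d) : ℂ :=
  -delDelbar (fun w => Real.log (h.inner ((chartAt (Cn d) x).symm w)
    (frame L x₀ ((chartAt (Cn d) x).symm w)) (frame L x₀ ((chartAt (Cn d) x).symm w))).re) z u v

/-- `(L, h)` is a (pre)quantum line bundle for the Kähler form `ω`: the curvature of its Chern
connection is `-i ω`. -/
def IsPrequantum (K : KahlerForm d M) (h : HermitianMetric d L) : Prop :=
  ∀ (x₀ x : M), ∀ z ∈ (chartAt (Cn d) x).target,
    (chartAt (Cn d) x).symm z ∈ (trivializationAt ℂ L x₀).baseSet → ∀ u v : Cn d,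
      h.chernCurvature x₀ x z u v = -Complex.I * (chartForm K.form x z ![u, v] : ℂ)

variable (d L) in
/-- `L` is very ample: its global holomorphic sections have no common zero, separate points and
separate tangent vectors, i.e. they define an embedding of `M` into a projective space. -/
def IsVeryAmple : Prop :=
  (∀ x : M, ∃ s : Cₛ^ω⟮𝓘(ℂ, Cn d); ℂ, L⟯, s x ≠ 0) ∧
  (∀ x y : M, x ≠ y → ∃ s : Cₛ^ω⟮𝓘(ℂ, Cn d); ℂ, L⟯, s x = 0 ∧ s y ≠ 0) ∧
  (∀ (x : M) (v : TangentSpace 𝓘(ℂ, Cn d) x), v ≠ 0 →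
    ∃ s : Cₛ^ω⟮𝓘(ℂ, Cn d); ℂ, L⟯, s x = 0 ∧
      mfderiv 𝓘(ℂ, Cn d) 𝓘(ℂ, ℂ)
        (fun y => (trivializationAt ℂ L x).linearMapAt ℂ y (s y)) x v ≠ 0)

/-- The space `H⁰(M, L)` of global holomorphic sections, to be equipped with the inner product
given by the Kähler form and the Hermitian metric. -/
def QuantumSpace (_K : KahlerForm d M) (_h : HermitianMetric d L) : Type _ :=
  Cₛ^ω⟮𝓘(ℂ, Cn d); ℂ, L⟯

namespace QuantumSpace

variable {K : KahlerForm d M} {h : HermitianMetric d L}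

instance : DFunLike (QuantumSpace K h) M L :=
  inferInstanceAs (DFunLike Cₛ^ω⟮𝓘(ℂ, Cn d); ℂ, L⟯ M L)

instance : AddCommGroup (QuantumSpace K h) :=
  inferInstanceAs (AddCommGroup Cₛ^ω⟮𝓘(ℂ, Cn d); ℂ, L⟯)

instance : Module ℂ (QuantumSpace K h) :=
  inferInstanceAs (Module ℂ Cₛ^ω⟮𝓘(ℂ, Cn d); ℂ, L⟯)

theorem add_apply (s t : QuantumSpace K h) (x : M) : (s + t) x = s x + t x := rfl

theorem smul_apply (c : ℂ) (s : QuantumSpace K h) (x : M) : (c • s) x = c • s x := rfl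

theorem zero_apply (x : M) : (0 : QuantumSpace K h) x = 0 := rfl

theorem contMDiffAt_coord (s : QuantumSpace K h) (x₀ : M) :
    ContMDiffAt 𝓘(ℂ, Cn d) 𝓘(ℂ, ℂ) ω
      (fun x => (trivializationAt ℂ L x₀).linearMapAt ℂ x (s x)) x₀ := by
  have h1 := (Bundle.contMDiffAt_section (IB := 𝓘(ℂ, Cn d)) (F := ℂ) (E := L) (n := ω) x₀).1
    (ContMDiffSection.contMDiff (s : Cₛ^ω⟮𝓘(ℂ, Cn d); ℂ, L⟯) x₀)
  refine h1.congr_of_eventuallyEq ?_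
  filter_upwards [(trivializationAt ℂ L x₀).open_baseSet.mem_nhds
    (mem_baseSet_trivializationAt ℂ L x₀)] with x hx
  rw [Trivialization.coe_linearMapAt_of_mem _ hx]
  rfl

theorem continuous_inner_apply (s t : QuantumSpace K h) :
    Continuous fun x => h.inner x (s x) (t x) := by
  refine continuous_iff_continuousAt.2 fun x₀ => ?_
  set e := trivializationAt ℂ L x₀ with he
  have hx₀ : x₀ ∈ e.baseSet := mem_baseSet_trivializationAt ℂ L x₀
  have hs := (s.contMDiffAt_coord x₀).continuousAt
  have ht := (t.contMDiffAt_coord x₀).continuousAt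
  have hh := ((h.smooth x₀).continuousOn).continuousAt (e.open_baseSet.mem_nhds hx₀)
  refine (((Complex.continuous_conj.continuousAt.comp hs).mul ht).mul
    (Complex.continuous_ofReal.continuousAt.comp hh)).congr ?_
  filter_upwards [e.open_baseSet.mem_nhds hx₀] with x hx
  have key : ∀ u : L x, u = (e.linearMapAt ℂ x u) • frame L x₀ x := fun u => by
    have h1 : frame L x₀ x = e.symmₗ ℂ x 1 := by
      rw [e.coe_symmₗ hx]; rfl
    rw [h1, ← map_smul, smul_eq_mul, mul_one, e.symmₗ_linearMapAt hx]
  have him : ((h.inner x (frame L x₀ x) (frame L x₀ x)).re : ℂ) =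
      h.inner x (frame L x₀ x) (frame L x₀ x) :=
    Complex.conj_eq_iff_re.1 (h.conj_symm x _ _)
  conv_rhs => rw [key (s x), key (t x)]
  simp only [Pi.mul_apply, Function.comp_apply, him, map_smulₛₗ, LinearMap.smul_apply, smul_eq_mul,
    RingHom.id_apply, he]
  ring

variable [CompactSpace M] [MeasurableSpace M] [BorelSpace M]

theorem integrable_inner_apply (s t : QuantumSpace K h) :
    Integrable (fun x => h.inner x (s x) (t x)) K.volumeMeasure :=
  (continuous_inner_apply s t).integrable_of_hasCompactSupport
    (HasCompactSupport.of_compactSpace _)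

/-- The `L²` inner product `⟨s, t⟩ = ∫_M h(s, t) dμ` on `H⁰(M, L)`. -/
@[reducible]
def innerCore (K : KahlerForm d M) (h : HermitianMetric d L) :
    InnerProductSpace.Core ℂ (QuantumSpace K h) where
  inner s t := ∫ x, h.inner x (s x) (t x) ∂K.volumeMeasure
  conj_inner_symm s t := by
    rw [← integral_conj]
    simp only [h.conj_symm]
  re_inner_nonneg s := by
    rw [RCLike.re_eq_complex_re, ← RCLike.re_eq_complex_re,
      ← integral_re (integrable_inner_apply s s)]
    refine integral_nonneg fun x => ?_
    by_cases hx : s x = 0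
    · simp [hx]
    · exact (h.pos x _ hx).le
  add_left s t u := by
    rw [← integral_add (integrable_inner_apply s u) (integrable_inner_apply t u)]
    simp only [add_apply, map_add, LinearMap.add_apply]
  smul_left s t c := by
    rw [← integral_const_mul]
    simp only [smul_apply, map_smulₛₗ, LinearMap.smul_apply, smul_eq_mul]
  definite s hs := by
    have h0 : ∫ x, (h.inner x (s x) (s x)).re ∂K.volumeMeasure = 0 := by
      have := integral_re (integrable_inner_apply s s)
      simp only [RCLike.re_eq_complex_re] at this
      rw [this, hs, Complex.zero_re]
    have hc : Continuous fun x => (h.inner x (s x) (s x)).re :=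
      Complex.continuous_re.comp (continuous_inner_apply s s)
    have hnn : 0 ≤ fun x => (h.inner x (s x) (s x)).re := fun x => by
      by_cases hx : s x = 0
      · simp [hx]
      · exact (h.pos x _ hx).le
    have h1 := (integral_eq_zero_iff_of_nonneg hnn (integrable_inner_apply s s).re).1 h0
    have h2 := (Continuous.ae_eq_iff_eq K.volumeMeasure hc continuous_zero).1 h1
    refine DFunLike.ext _ _ fun x => ?_
    by_contra hx
    exact (h.pos x _ hx).ne' (congrFun h2 x)

instance : NormedAddCommGroup (QuantumSpace K h) := (innerCore K h).toNormedAddCommGroup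

instance : InnerProductSpace ℂ (QuantumSpace K h) := .ofCore (innerCore K h).toCore

end QuantumSpace

/-- The restriction map `R_Λ` from holomorphic sections of `L` to arbitrary sections of `L` over
the subset `Λ`. -/
def restrictSections (K : KahlerForm d M) (h : HermitianMetric d L) (Λ : Set M) :
    QuantumSpace K h →ₗ[ℂ] (∀ x : Λ, L x) where
  toFun s x := s x
  map_add' _ _ := rfl
  map_smul' _ _ := rfl

end LineBundles

section ExternalTensorProduct

variable {d₁ d₂ : ℕ} {M₁ M₂ : Type*} [TopologicalSpace M₁] [ChartedSpace (Cn d₁) M₁]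
  [TopologicalSpace M₂] [ChartedSpace (Cn d₂) M₂]
  (L₁ : M₁ → Type*) [TopologicalSpace (TotalSpace ℂ L₁)] [∀ x, TopologicalSpace (L₁ x)]
  [∀ x, AddCommGroup (L₁ x)] [∀ x, Module ℂ (L₁ x)] [FiberBundle ℂ L₁] [VectorBundle ℂ ℂ L₁]
  (L₂ : M₂ → Type*) [TopologicalSpace (TotalSpace ℂ L₂)] [∀ x, TopologicalSpace (L₂ x)]
  [∀ x, AddCommGroup (L₂ x)] [∀ x, Module ℂ (L₂ x)] [FiberBundle ℂ L₂] [VectorBundle ℂ ℂ L₂]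

/-- The fibre `(L₁)_x ⊗ (L₂)_y` of the external tensor product `L₁ ⊠ L₂` at `(x, y)`. -/
abbrev ExtFiber (p : M₁ × M₂) : Type _ := L₁ p.1 ⊗[ℂ] L₂ p.2

/-- The local trivialization of `L₁ ⊠ L₂` around `p₀`, on the fibre at `p`: the tensor product of
the trivializations of `L₁` and `L₂`, followed by `ℂ ⊗ ℂ ≅ ℂ`. -/
def extCoord (p₀ p : M₁ × M₂) : ExtFiber L₁ L₂ p →ₗ[ℂ] ℂ :=
  TensorProduct.lift ((LinearMap.mul ℂ ℂ).compl₁₂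
    ((trivializationAt ℂ L₁ p₀.1).linearMapAt ℂ p.1)
    ((trivializationAt ℂ L₂ p₀.2).linearMapAt ℂ p.2))

variable (d₁ d₂) in
/-- The space `H⁰(M₁ × M₂, L₁ ⊠ L₂)` of global holomorphic sections of the external tensor
product: the sections which are holomorphic in the local trivializations. -/
def ExtSections : Submodule ℂ (∀ p : M₁ × M₂, ExtFiber L₁ L₂ p) where
  carrier := {s | ∀ p₀ : M₁ × M₂, ContMDiffAt (𝓘(ℂ, Cn d₁).prod 𝓘(ℂ, Cn d₂)) 𝓘(ℂ, ℂ) ω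
    (fun p => extCoord L₁ L₂ p₀ p (s p)) p₀}
  add_mem' hs ht p₀ := by
    simpa only [Pi.add_apply, map_add] using! (hs p₀).add (ht p₀)
  zero_mem' p₀ := by
    simpa only [Pi.zero_apply, map_zero] using! contMDiffAt_const
  smul_mem' c s hs p₀ := by
    simpa only [Pi.smul_apply, map_smul] using!
      (contMDiffAt_const (c := c) (I := 𝓘(ℂ, Cn d₁).prod 𝓘(ℂ, Cn d₂)) (I' := 𝓘(ℂ, ℂ))).mul (hs p₀)

variable (d₁ d₂) in
/-- The restriction map `R_Λ` for subsets `Λ` of `M₁ × M₂`. -/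
def restrictExtSections (Λ : Set (M₁ × M₂)) :
    ExtSections d₁ d₂ L₁ L₂ →ₗ[ℂ] (∀ p : Λ, ExtFiber L₁ L₂ (p : M₁ × M₂)) where
  toFun s p := s.1 p
  map_add' _ _ := rfl
  map_smul' _ _ := rfl

variable {L₁ L₂}

/-- The section `(x, y) ↦ s(x) ⊗ t(y)` of `L₁ ⊠ L₂`. -/
def extProd {K₁ : KahlerForm d₁ M₁} {h₁ : HermitianMetric d₁ L₁} {K₂ : KahlerForm d₂ M₂}
    {h₂ : HermitianMetric d₂ L₂} (s : QuantumSpace K₁ h₁) (t : QuantumSpace K₂ h₂) :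
    ExtSections d₁ d₂ L₁ L₂ :=
  ⟨fun p => s p.1 ⊗ₜ[ℂ] t p.2, fun p₀ => by
    have hs := (s.contMDiffAt_coord p₀.1).comp p₀
      (contMDiffAt_fst (I := 𝓘(ℂ, Cn d₁)) (J := 𝓘(ℂ, Cn d₂)))
    have ht := (t.contMDiffAt_coord p₀.2).comp p₀
      (contMDiffAt_snd (I := 𝓘(ℂ, Cn d₁)) (J := 𝓘(ℂ, Cn d₂)))
    exact hs.mul ht⟩

/-- The canonical linear map `H⁰(M₁, L₁) ⊗ H⁰(M₂, L₂) → H⁰(M₁ × M₂, L₁ ⊠ L₂)` sending `s ⊗ t` to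
the section `(x, y) ↦ s(x) ⊗ t(y)`. -/
def kunneth (K₁ : KahlerForm d₁ M₁) (h₁ : HermitianMetric d₁ L₁) (K₂ : KahlerForm d₂ M₂)
    (h₂ : HermitianMetric d₂ L₂) :
    QuantumSpace K₁ h₁ ⊗[ℂ] QuantumSpace K₂ h₂ →ₗ[ℂ] ExtSections d₁ d₂ L₁ L₂ :=
  TensorProduct.lift (LinearMap.mk₂ ℂ extProd
    (fun _ _ _ => Subtype.ext (funext fun _ => TensorProduct.add_tmul _ _ _))
    (fun _ _ _ => Subtype.ext (funext fun _ => TensorProduct.smul_tmul' _ _ _))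
    (fun _ _ _ => Subtype.ext (funext fun _ => TensorProduct.tmul_add _ _ _))
    (fun _ _ _ => Subtype.ext (funext fun _ => TensorProduct.tmul_smul _ _ _)))

end ExternalTensorProduct

/-- For subspaces `P ⊆ V` and `Q ⊆ W`, the subspace `P ⊗ Q` of `V ⊗ W`. -/
def tensorSubspace {V W : Type*} [AddCommGroup V] [Module ℂ V] [AddCommGroup W] [Module ℂ W]
    (P : Submodule ℂ V) (Q : Submodule ℂ W) : Submodule ℂ (V ⊗[ℂ] W) :=
  LinearMap.range (TensorProduct.mapIncl P Q)

end KahlerQuantization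

end

noncomputable section

namespace KahlerQuantization

/-! ### Tensor products of function spaces, recognised by slices -/

section LinearAlgebra

/-! In a trivialization, evaluation at a point `x` is a linear functional on the space of sections.
Once that space is known to be finite-dimensional, Riesz represents the functional by a vector `e x`
(a coherent state), and the orthogonal complement of the sections vanishing on `Λ₁` is the span of
the `e x` with `x ∈ Λ₁`; likewise with vectors `k y` on the second factor. Evaluating the section
attached to a tensor `τ` at `(x, y)` amounts to pairing `τ` with `e x ⊗ k y`. Hence, writing `N₁`,
`N₂` for the two kernels, the kernel over `Λ₁ × Λ₂` is `(N₁ᗮ ⊗ N₂ᗮ)ᗮ`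
(`eq_orthogonal_tensorSubspace`, `comap_ker_restrictExtSections`). The rest is the identity `(P ⊗
Q)ᗮ = V ⊗ Qᗮ + Pᗮ ⊗ Q` (`orthogonal_tensorSubspace`) with `P = N₁ᗮ`, `Q = N₂ᗮ`, and double
orthogonal complements.

Two analytic facts support this. Finite-dimensionality comes from the Schwarz lemma and compactness:
a section vanishing at finitely many suitably chosen points has norm at most a fixed fraction of its
maximum everywhere, so it is zero. The canonical map is bijective because point evaluations span the
dual of the finite-dimensional first factor: the coefficients of a section of `L₁ ⊠ L₂` in a basis
of that factor are finite combinations of its slices `{x} × M₂`, hence are holomorphic sections of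
`L₂`. -/

/-- A map from a tensor product of spaces of functions on `X` and `Y` to a space of functions on
`X × Y` is bijective if the slices of the latter functions lie in the given spaces and the first
space is finite-dimensional. -/
theorem bijective_of_slices {X Y V W E : Type*} [AddCommGroup V] [Module ℂ V]
    [FiniteDimensional ℂ V] [AddCommGroup W] [Module ℂ W] [AddCommGroup E] [Module ℂ E]
    {ev₁ : X → Module.Dual ℂ V} {ev₂ : Y → Module.Dual ℂ W} {ev : X → Y → E → ℂ}
    {slice₂ : X → E →ₗ[ℂ] W} {slice₁ : Y → E →ₗ[ℂ] V} {κ : V ⊗[ℂ] W →ₗ[ℂ] E}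
    (sep₁ : ∀ s, (∀ x, ev₁ x s = 0) → s = 0) (sep₂ : ∀ t, (∀ y, ev₂ y t = 0) → t = 0)
    (sep : ∀ S T, (∀ x y, ev x y S = ev x y T) → S = T)
    (h₂ : ∀ x y S, ev₂ y (slice₂ x S) = ev x y S) (h₁ : ∀ x y S, ev₁ x (slice₁ y S) = ev x y S)
    (hκ : ∀ x y s t, ev x y (κ (s ⊗ₜ t)) = ev₁ x s * ev₂ y t) :
    Function.Bijective κ := by
  let b := Module.finBasis ℂ V
  -- In finite dimension a family of functionals with no common nonzero zero spans the dual, so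
  -- every coordinate functional is a finite combination of evaluations.
  have hspan : Submodule.span ℂ (Set.range ev₁) = ⊤ := by
    refine Submodule.span_eq_top_of_ne_zero fun s hs => ?_
    by_contra! hcon
    exact hs (sep₁ s fun x => hcon _ ⟨x, rfl⟩)
  have hc : ∀ i, ∃ c : X →₀ ℂ, (c.sum fun x a => a • ev₁ x) = b.coord i := fun i =>
    Finsupp.mem_span_range_iff_exists_finsupp.1 (hspan ▸ Submodule.mem_top)
  choose c hc using hc
  -- `T i S` is the `i`-th coefficient of `S` in the expansion `S = ∑ i, b i ⊗ T i S`. It lies in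
  -- `W` because it is a finite combination of slices.
  let T : Fin (Module.finrank ℂ V) → E →ₗ[ℂ] W := fun i => (c i).sum fun x a => a • slice₂ x
  have hT : ∀ i y S, ev₂ y (T i S) = b.coord i (slice₁ y S) := fun i y S => by
    rw [← hc i]
    simp only [T, Finsupp.sum, LinearMap.sum_apply, LinearMap.smul_apply, map_sum, map_smul, h₁, h₂]
  have hev : ∀ x y S, ev x y (κ (∑ i, b i ⊗ₜ T i S)) = ev x y S := fun x y S => by
    -- `ev x y` is not assumed linear, so sums are moved through the linear map `ev₁ x ∘ slice₁ y`.
    rw [← h₁, map_sum, map_sum, map_sum, ← h₁]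
    simp only [h₁ _ _ (κ _), hκ, hT]
    conv_rhs => rw [← b.sum_repr (slice₁ y S), map_sum]
    simp only [map_smul, smul_eq_mul, Module.Basis.coord_apply, mul_comm]
  refine ⟨?_, fun S => ⟨∑ i, b i ⊗ₜ T i S, sep _ _ fun x y => hev x y S⟩⟩
  have hTκ : ∀ i s t, T i (κ (s ⊗ₜ t)) = b.coord i s • t := fun i s t => by
    refine sub_eq_zero.1 (sep₂ _ fun y => ?_)
    have h : slice₁ y (κ (s ⊗ₜ t)) = ev₂ y t • s := by
      refine sub_eq_zero.1 (sep₁ _ fun x => ?_)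
      simp [h₁, hκ, mul_comm]
    rw [map_sub, hT, h]
    simp [mul_comm]
  -- The expansion that gave surjectivity is also a left inverse of `κ`, as is seen on pure tensors.
  refine Function.LeftInverse.injective
    (g := (∑ i, (TensorProduct.mk ℂ V W (b i)) ∘ₗ T i : E →ₗ[ℂ] V ⊗[ℂ] W)) fun τ => ?_
  induction τ using TensorProduct.induction_on with
  | zero => simp
  | add τ τ' h h' => rw [map_add, map_add, h, h']
  | tmul s t =>
    simp only [LinearMap.sum_apply, LinearMap.comp_apply, hTκ, TensorProduct.mk_apply,
      ← TensorProduct.smul_tmul, ← TensorProduct.sum_tmul, Module.Basis.coord_apply, b.sum_repr]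

/-! ### Orthogonal complements in a tensor product of inner product spaces -/

variable {V W : Type*} [NormedAddCommGroup V] [InnerProductSpace ℂ V] [NormedAddCommGroup W]
  [InnerProductSpace ℂ W]

theorem tensorSubspace_le_iff {P : Submodule ℂ V} {Q : Submodule ℂ W}
    {N : Submodule ℂ (V ⊗[ℂ] W)} :
    tensorSubspace P Q ≤ N ↔ ∀ p ∈ P, ∀ q ∈ Q, p ⊗ₜ[ℂ] q ∈ N := by
  rw [tensorSubspace, TensorProduct.range_mapIncl, Submodule.map₂_le]
  rfl

theorem tmul_mem_tensorSubspace {P : Submodule ℂ V} {Q : Submodule ℂ W} {p : V} {q : W}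
    (hp : p ∈ P) (hq : q ∈ Q) : p ⊗ₜ[ℂ] q ∈ tensorSubspace P Q :=
  tensorSubspace_le_iff.1 le_rfl p hp q hq

theorem mem_orthogonal_tensorSubspace {P : Submodule ℂ V} {Q : Submodule ℂ W} {τ : V ⊗[ℂ] W} :
    τ ∈ (tensorSubspace P Q)ᗮ ↔ ∀ p ∈ P, ∀ q ∈ Q, ⟪p ⊗ₜ[ℂ] q, τ⟫_ℂ = 0 := by
  -- Orthogonality to `τ` is rephrased as inclusion in the complement of the line through `τ`, so
  -- that it need only be tested on pure tensors.
  rw [← Submodule.span_singleton_le_iff_mem, ← Submodule.isOrtho_iff_le, Submodule.isOrtho_comm,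
    Submodule.isOrtho_iff_le, tensorSubspace_le_iff]
  simp only [Submodule.mem_orthogonal_singleton_iff_inner_left]

/-- Inner products of pure tensors are products, so one orthogonal pair of factors suffices. -/
theorem isOrtho_tensorSubspace_right (P P' : Submodule ℂ V) {Q Q' : Submodule ℂ W} (h : Q ⟂ Q') :
    tensorSubspace P Q ⟂ tensorSubspace P' Q' := by
  refine tensorSubspace_le_iff.2 fun p _ q hq =>
    mem_orthogonal_tensorSubspace.2 fun p' _ q' hq' => ?_
  rw [TensorProduct.inner_tmul, h.symm.inner_eq hq' hq, mul_zero]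

theorem isOrtho_tensorSubspace_left {P P' : Submodule ℂ V} (Q Q' : Submodule ℂ W) (h : P ⟂ P') :
    tensorSubspace P Q ⟂ tensorSubspace P' Q' := by
  refine tensorSubspace_le_iff.2 fun p hp q _ =>
    mem_orthogonal_tensorSubspace.2 fun p' hp' q' _ => ?_
  rw [TensorProduct.inner_tmul, h.symm.inner_eq hp' hp, zero_mul]

/-- The orthogonal complement of a tensor product of subspaces. -/
theorem orthogonal_tensorSubspace (P : Submodule ℂ V) (Q : Submodule ℂ W)
    [P.HasOrthogonalProjection] [Q.HasOrthogonalProjection] :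
    (tensorSubspace P Q)ᗮ = tensorSubspace ⊤ Qᗮ ⊔ tensorSubspace Pᗮ Q := by
  have hle : tensorSubspace ⊤ Qᗮ ⊔ tensorSubspace Pᗮ Q ≤ (tensorSubspace P Q)ᗮ :=
    sup_le (isOrtho_tensorSubspace_right _ _ Q.isOrtho_orthogonal_right.symm)
      (isOrtho_tensorSubspace_left _ _ P.isOrtho_orthogonal_right.symm)
  -- Splitting both factors along `P`, `Pᗮ` and `Q`, `Qᗮ` shows that the proposed complement and `P
  -- ⊗ Q` together fill the space.
  have htop : (tensorSubspace ⊤ Qᗮ ⊔ tensorSubspace Pᗮ Q) ⊔ tensorSubspace P Q = ⊤ := by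
    refine eq_top_iff.2 fun τ _ => ?_
    induction τ using TensorProduct.induction_on with
    | zero => exact zero_mem _
    | add τ τ' h h' => exact add_mem (h trivial) (h' trivial)
    | tmul v w =>
      obtain ⟨p, hp, p', hp', rfl⟩ := P.exists_add_mem_mem_orthogonal v
      obtain ⟨q, hq, q', hq', rfl⟩ := Q.exists_add_mem_mem_orthogonal w
      rw [TensorProduct.tmul_add, TensorProduct.add_tmul p p' q]
      refine add_mem (add_mem ?_ ?_) ?_
      · exact Submodule.mem_sup_right (tmul_mem_tensorSubspace hp hq)
      · exact Submodule.mem_sup_left (Submodule.mem_sup_right (tmul_mem_tensorSubspace hp' hq))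
      · exact Submodule.mem_sup_left (Submodule.mem_sup_left
          (tmul_mem_tensorSubspace Submodule.mem_top hq'))
  refine le_antisymm (fun τ hτ => ?_) hle
  -- The component `β` in `P ⊗ Q` of a vector orthogonal to `P ⊗ Q` is orthogonal to itself, hence
  -- zero.
  obtain ⟨α, hα, β, hβ, rfl⟩ := Submodule.mem_sup.1 (htop ▸ Submodule.mem_top : τ ∈ _)
  have h0 : β ∈ (tensorSubspace P Q)ᗮ := by simpa using sub_mem hτ (hle hα)
  have : β = 0 := by
    have := (Submodule.mem_orthogonal _ _).1 h0 β hβ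
    exact inner_self_eq_zero.1 this
  simpa [this] using hα

theorem mem_orthogonal_span_range_iff {X : Type*} {e : X → V} {s : V} :
    s ∈ (Submodule.span ℂ (Set.range e))ᗮ ↔ ∀ x, ⟪e x, s⟫_ℂ = 0 := by
  rw [← Submodule.span_singleton_le_iff_mem, ← Submodule.isOrtho_iff_le, Submodule.isOrtho_comm,
    Submodule.isOrtho_iff_le, Submodule.span_le, Set.range_subset_iff]
  simp only [SetLike.mem_coe, Submodule.mem_orthogonal_singleton_iff_inner_left]

/-- Tensors annihilated by all products of two families of functionals are orthogonal to the
tensor product of the orthogonal complements of the common kernels of these families. -/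
theorem eq_orthogonal_tensorSubspace [FiniteDimensional ℂ V] [FiniteDimensional ℂ W]
    {X Y : Type*} {f : X → Module.Dual ℂ V} {g : Y → Module.Dual ℂ W} {N₁ : Submodule ℂ V}
    {N₂ : Submodule ℂ W} {N : Submodule ℂ (V ⊗[ℂ] W)} (hN₁ : ∀ s, s ∈ N₁ ↔ ∀ x, f x s = 0)
    (hN₂ : ∀ t, t ∈ N₂ ↔ ∀ y, g y t = 0)
    (hN : ∀ τ, τ ∈ N ↔ ∀ x y, LinearMap.mul' ℂ ℂ (TensorProduct.map (f x) (g y) τ) = 0) :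
    N = (tensorSubspace N₁ᗮ N₂ᗮ)ᗮ := by
  -- Riesz vectors of the functionals; their spans are the complements of the common kernels, by
  -- taking double complements.
  let e : X → V := fun x => (InnerProductSpace.toDual ℂ V).symm (f x).toContinuousLinearMap
  let k : Y → W := fun y => (InnerProductSpace.toDual ℂ W).symm (g y).toContinuousLinearMap
  have he : ∀ x s, ⟪e x, s⟫_ℂ = f x s := fun x s => InnerProductSpace.toDual_symm_apply
  have hk : ∀ y t, ⟪k y, t⟫_ℂ = g y t := fun y t => InnerProductSpace.toDual_symm_apply
  have h₁ : N₁ᗮ = Submodule.span ℂ (Set.range e) := by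
    rw [← (Submodule.span ℂ (Set.range e)).orthogonal_orthogonal]
    congr 1
    ext s
    rw [hN₁, mem_orthogonal_span_range_iff]
    simp only [he]
  have h₂ : N₂ᗮ = Submodule.span ℂ (Set.range k) := by
    rw [← (Submodule.span ℂ (Set.range k)).orthogonal_orthogonal]
    congr 1
    ext s
    rw [hN₂, mem_orthogonal_span_range_iff]
    simp only [hk]
  have hek : ∀ x y τ,
      LinearMap.mul' ℂ ℂ (TensorProduct.map (f x) (g y) τ) = ⟪e x ⊗ₜ[ℂ] k y, τ⟫_ℂ := fun x y τ => by
      induction τ using TensorProduct.induction_on with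
      | zero => simp
      | add τ τ' h h' => rw [map_add, map_add, h, h', inner_add_right]
      | tmul s t => simp [he, hk]
  ext τ
  rw [hN, mem_orthogonal_tensorSubspace, h₁, h₂]
  simp only [hek]
  refine ⟨fun h p hp q hq => ?_, fun h x y => h _ (Submodule.subset_span ⟨x, rfl⟩) _
    (Submodule.subset_span ⟨y, rfl⟩)⟩
  -- Vanishing on the generators `e x ⊗ k y` extends to both spans by sesquilinearity.
  induction hp, hq using Submodule.span_induction₂ with
  | mem_mem p q hp hq =>
    obtain ⟨x, rfl⟩ := hp
    obtain ⟨y, rfl⟩ := hq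
    exact h x y
  | zero_left q _ => rw [TensorProduct.zero_tmul, inner_zero_left]
  | zero_right p _ => rw [TensorProduct.tmul_zero, inner_zero_left]
  | add_left p p' q _ _ _ h h' => rw [TensorProduct.add_tmul, inner_add_left, h, h', add_zero]
  | add_right p q q' _ _ _ h h' => rw [TensorProduct.tmul_add, inner_add_left, h, h', add_zero]
  | smul_left c p q _ _ h => exact (inner_smul_left (p ⊗ₜ[ℂ] q) τ c).trans (by rw [h, mul_zero])
  | smul_right c p q _ _ h =>
    rw [TensorProduct.tmul_smul]
    exact (inner_smul_left (p ⊗ₜ[ℂ] q) τ c).trans (by rw [h, mul_zero])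

end LinearAlgebra

/-! ### Finite-dimensionality of spaces of holomorphic sections -/

section LineBundles

open Topology

variable {d : ℕ} {M : Type*} [TopologicalSpace M] [ChartedSpace (Cn d) M]
  {L : M → Type*} [TopologicalSpace (TotalSpace ℂ L)] [∀ x, TopologicalSpace (L x)]
  [∀ x, AddCommGroup (L x)] [∀ x, Module ℂ (L x)] [FiberBundle ℂ L] [VectorBundle ℂ ℂ L]

theorem linearMapAt_smul_frame {x₀ x : M} (hx : x ∈ (trivializationAt ℂ L x₀).baseSet) (u : L x) :
    (trivializationAt ℂ L x₀).linearMapAt ℂ x u • frame L x₀ x = u := by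
  have h : frame L x₀ x = (trivializationAt ℂ L x₀).symmₗ ℂ x 1 := by
    rw [(trivializationAt ℂ L x₀).coe_symmₗ hx]; rfl
  rw [h, ← map_smul, smul_eq_mul, mul_one, (trivializationAt ℂ L x₀).symmₗ_linearMapAt hx]

theorem frame_ne_zero {x₀ x : M} (hx : x ∈ (trivializationAt ℂ L x₀).baseSet) :
    frame L x₀ x ≠ 0 := fun h => by
  have h1 := (trivializationAt ℂ L x₀).linearMapAt_symmₗ (R := ℂ) hx 1
  rw [(trivializationAt ℂ L x₀).coe_symmₗ hx] at h1
  change (trivializationAt ℂ L x₀).linearMapAt ℂ x (frame L x₀ x) = 1 at h1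
  simp [h] at h1

/-- Since the fibres are lines, the metric is one positive weight in a frame. This lets estimates
for scalar holomorphic functions pass to pointwise norms of sections. -/
theorem HermitianMetric.inner_self_re (h : HermitianMetric d L) {x₀ x : M}
    (hx : x ∈ (trivializationAt ℂ L x₀).baseSet) (u : L x) :
    (h.inner x u u).re = ‖(trivializationAt ℂ L x₀).linearMapAt ℂ x u‖ ^ 2 *
      (h.inner x (frame L x₀ x) (frame L x₀ x)).re := by
  conv_lhs => rw [← linearMapAt_smul_frame hx u]
  simp only [map_smulₛₗ, LinearMap.smul_apply, smul_eq_mul, RingHom.id_apply]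
  rw [← mul_assoc, Complex.mul_conj, Complex.re_ofReal_mul,
    Complex.normSq_eq_norm_sq]

namespace QuantumSpace

variable {K : KahlerForm d M} {h : HermitianMetric d L}

/-- The value of a section at `x`, as a complex number by means of the trivialization at `x`. -/
def evalAt (K : KahlerForm d M) (h : HermitianMetric d L) (x : M) :
    Module.Dual ℂ (QuantumSpace K h) where
  toFun s := (trivializationAt ℂ L x).linearMapAt ℂ x (s x)
  map_add' s t := by rw [add_apply, map_add]
  map_smul' c s := by rw [smul_apply, map_smul, RingHom.id_apply]

theorem evalAt_eq_zero_iff {x : M} {s : QuantumSpace K h} : evalAt K h x s = 0 ↔ s x = 0 := by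
  refine ⟨fun hs => ?_, fun hs => ?_⟩
  · change (trivializationAt ℂ L x).linearMapAt ℂ x (s x) = 0 at hs
    rw [← linearMapAt_smul_frame (mem_baseSet_trivializationAt ℂ L x) (s x), hs, zero_smul]
  · change (trivializationAt ℂ L x).linearMapAt ℂ x (s x) = 0
    rw [hs, map_zero]

/-- The expression of a holomorphic section in a chart and the corresponding trivialization. -/
theorem differentiableOn_coord [IsManifold 𝓘(ℂ, Cn d) ω M] [ContMDiffVectorBundle ω ℂ L 𝓘(ℂ, Cn d)]
    (s : QuantumSpace K h) (x : M) :
    DifferentiableOn ℂ (fun z => (trivializationAt ℂ L x).linearMapAt ℂ ((chartAt (Cn d) x).symm z)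
      (s ((chartAt (Cn d) x).symm z))) ((chartAt (Cn d) x).target ∩
        (chartAt (Cn d) x).symm ⁻¹' (trivializationAt ℂ L x).baseSet) := by
  have h1 := ((trivializationAt ℂ L x).contMDiffOn_section_baseSet_iff (IB := 𝓘(ℂ, Cn d))
    (n := ω)).1 (ContMDiffSection.contMDiff (s : Cₛ^ω⟮𝓘(ℂ, Cn d); ℂ, L⟯)).contMDiffOn
  have h2 := h1.comp ((contMDiffOn_chart_symm (I := 𝓘(ℂ, Cn d)) (n := ω) (x := x)).mono
    (Set.inter_subset_left (t := (chartAt (Cn d) x).symm ⁻¹' (trivializationAt ℂ L x).baseSet)))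
    Set.inter_subset_right
  refine ((contMDiffOn_iff_contDiffOn.1 h2).differentiableOn (by simp)).congr fun z hz => ?_
  rw [Trivialization.coe_linearMapAt_of_mem _ hz.2]
  rfl

/-- A holomorphic section vanishing at `x` is uniformly small, compared to its supremum, near
`x`. -/
theorem exists_nhds_inner_self_le [IsManifold 𝓘(ℂ, Cn d) ω M]
    [ContMDiffVectorBundle ω ℂ L 𝓘(ℂ, Cn d)] (K : KahlerForm d M) (h : HermitianMetric d L)
    (x : M) : ∃ U ∈ 𝓝 x, ∀ s : QuantumSpace K h, s x = 0 → ∀ C : ℝ,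
      (∀ y, (h.inner y (s y) (s y)).re ≤ C) → ∀ y ∈ U, (h.inner y (s y) (s y)).re ≤ C / 2 := by
  set φ := chartAt (Cn d) x
  set e := trivializationAt ℂ L x
  set ρ : M → ℝ := fun y => (h.inner y (frame L x y) (frame L x y)).re
  have hxe : x ∈ e.baseSet := mem_baseSet_trivializationAt ℂ L x
  have hxs : x ∈ φ.source := mem_chart_source _ x
  have hxx : φ.symm (φ x) = x := φ.left_inv hxs
  have ha : 0 < ρ x := h.pos x _ (frame_ne_zero hxe)
  have hρc : ContinuousAt ρ x := (h.smooth x).continuousOn.continuousAt (e.open_baseSet.mem_nhds hxe)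
  -- Near `x` the weight varies by at most a factor 2 either way. The radius `R / 4` below makes the
  -- Schwarz lemma gain `1 / 16` on squared norms, which outweighs the total loss of 4.
  have hρI : ∀ᶠ y in 𝓝 x, y ∈ e.baseSet ∧ ρ y ∈ Set.Ioo (ρ x / 2) (2 * ρ x) :=
    (e.open_baseSet.eventually_mem hxe).and (hρc (Ioo_mem_nhds (by linarith) (by linarith)))
  have hev : ∀ᶠ z in 𝓝 (φ x), z ∈ φ.target ∧ φ.symm z ∈ e.baseSet ∧
      ρ (φ.symm z) ∈ Set.Ioo (ρ x / 2) (2 * ρ x) :=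
    (φ.open_target.eventually_mem (φ.map_source hxs)).and
      ((φ.continuousAt_symm (φ.map_source hxs)).eventually (by rwa [hxx]))
  obtain ⟨R, hR, hball⟩ := Metric.eventually_nhds_iff_ball.1 hev
  refine ⟨φ.source ∩ φ ⁻¹' Metric.ball (φ x) (R / 4), Filter.inter_mem (φ.open_source.mem_nhds hxs)
    ((φ.continuousAt hxs).preimage_mem_nhds (Metric.ball_mem_nhds _ (by positivity))),
    fun s hs C hC y hy => ?_⟩
  set f : Cn d → ℂ := fun z => e.linearMapAt ℂ (φ.symm z) (s (φ.symm z)) with hf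
  have hf0 : f (φ x) = 0 := by
    simp only [hf]
    rw [hxx, hs, map_zero]
  have hnorm : ∀ z ∈ Metric.ball (φ x) R,
      (h.inner (φ.symm z) (s (φ.symm z)) (s (φ.symm z))).re = ‖f z‖ ^ 2 * ρ (φ.symm z) :=
    fun z hz => h.inner_self_re (hball z hz).2.1 _
  have hC0 : 0 ≤ C := by simpa [hs] using hC x
  -- From `‖f‖² ρ ≤ C` and `ρ > ρ x / 2`.
  have hmaps : Set.MapsTo f (Metric.ball (φ x) R)
      (Metric.closedBall (f (φ x)) (Real.sqrt (2 * C / ρ x))) := fun z hz => by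
    rw [hf0, mem_closedBall_zero_iff]
    refine Real.le_sqrt_of_sq_le ?_
    have h1 := hnorm z hz ▸ hC (φ.symm z)
    rw [le_div_iff₀ ha]
    nlinarith [(hball z hz).2.2.1, sq_nonneg ‖f z‖]
  have hyR : φ y ∈ Metric.ball (φ x) R := Metric.ball_subset_ball (by linarith) hy.2
  -- The Schwarz lemma, for `f` holomorphic on a ball of `ℂ^d` and vanishing at its centre.
  have hS : dist (f (φ y)) (f (φ x)) ≤ _ := Complex.dist_le_div_mul_dist_of_mapsTo_ball
    ((differentiableOn_coord s x).mono fun z hz => ⟨(hball z hz).1, (hball z hz).2.1⟩) hmaps hyR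
  rw [hf0, dist_zero_right] at hS
  have h2 : ‖f (φ y)‖ ≤ Real.sqrt (2 * C / ρ x) / 4 := by
    refine hS.trans ?_
    have h3 : dist (φ y) (φ x) ≤ R / 4 := (Metric.mem_ball.1 hy.2).le
    calc _ ≤ Real.sqrt (2 * C / ρ x) / R * (R / 4) := by gcongr
      _ = _ := by field_simp
  have h4 : ‖f (φ y)‖ ^ 2 ≤ C / (8 * ρ x) := by
    calc _ ≤ (Real.sqrt (2 * C / ρ x) / 4) ^ 2 := by gcongr
      _ = _ := by rw [div_pow, Real.sq_sqrt (by positivity)]; field_simp; ring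
  have h5 := hnorm (φ y) hyR
  rw [φ.left_inv hy.1] at h5
  obtain ⟨h6', h6⟩ := (hball _ hyR).2.2
  rw [φ.left_inv hy.1] at h6 h6'
  have h7 : 0 ≤ ρ y := by linarith
  rw [h5]
  calc _ ≤ C / (8 * ρ x) * (2 * ρ x) := by
        gcongr
    _ = C / 4 := by field_simp; ring
    _ ≤ C / 2 := by linarith

/-- The space of holomorphic sections of a line bundle on a compact complex manifold is
finite-dimensional. -/
instance finiteDimensional [CompactSpace M] [IsManifold 𝓘(ℂ, Cn d) ω M]
    [ContMDiffVectorBundle ω ℂ L 𝓘(ℂ, Cn d)] : FiniteDimensional ℂ (QuantumSpace K h) := by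
  choose U hU hUs using exists_nhds_inner_self_le K h
  obtain ⟨t, ht⟩ := isCompact_univ.elim_nhds_subcover U fun x _ => hU x
  -- Evaluation at the centres of a finite subcover is injective: for a section vanishing at all of
  -- them, the maximum of the squared norm is at most half of itself.
  let ev : QuantumSpace K h →ₗ[ℂ] (t → ℂ) := LinearMap.pi fun x => evalAt K h x
  refine FiniteDimensional.of_injective ev ((injective_iff_map_eq_zero ev).2 fun s hs => ?_)
  have hst : ∀ x ∈ t, s x = 0 := fun x hx => evalAt_eq_zero_iff.1 (congrFun hs ⟨x, hx⟩)
  refine DFunLike.ext _ _ fun y => ?_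
  obtain ⟨y₀, -, hy₀⟩ := isCompact_univ.exists_isMaxOn ⟨y, Set.mem_univ y⟩
    (Complex.continuous_re.comp (continuous_inner_apply s s)).continuousOn
  have hmax : ∀ z, (h.inner z (s z) (s z)).re ≤ (h.inner y₀ (s y₀) (s y₀)).re :=
    fun z => hy₀ (Set.mem_univ z)
  obtain ⟨x, hx, hxy⟩ := Set.mem_iUnion₂.1 (ht.2 (Set.mem_univ y₀))
  have h1 := hUs x s (hst x hx) _ hmax y₀ hxy
  by_contra hy
  linarith [h.pos y (s y) hy, hmax y]

end QuantumSpace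

end LineBundles

/-! ### The external tensor product: slices, canonical isomorphism, restriction kernel -/

section ExternalTensorProduct

variable {d₁ d₂ : ℕ} {M₁ M₂ : Type*} [TopologicalSpace M₁] [ChartedSpace (Cn d₁) M₁]
  [TopologicalSpace M₂] [ChartedSpace (Cn d₂) M₂]
  {L₁ : M₁ → Type*} [TopologicalSpace (TotalSpace ℂ L₁)] [∀ x, TopologicalSpace (L₁ x)]
  [∀ x, AddCommGroup (L₁ x)] [∀ x, Module ℂ (L₁ x)] [FiberBundle ℂ L₁] [VectorBundle ℂ ℂ L₁]
  {L₂ : M₂ → Type*} [TopologicalSpace (TotalSpace ℂ L₂)] [∀ x, TopologicalSpace (L₂ x)]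
  [∀ x, AddCommGroup (L₂ x)] [∀ x, Module ℂ (L₂ x)] [FiberBundle ℂ L₂] [VectorBundle ℂ ℂ L₂]
  {K₁ : KahlerForm d₁ M₁} {h₁ : HermitianMetric d₁ L₁} {K₂ : KahlerForm d₂ M₂}
  {h₂ : HermitianMetric d₂ L₂}

theorem extCoord_smul_frame_tmul_frame {p₀ p : M₁ × M₂}
    (h₁ : p.1 ∈ (trivializationAt ℂ L₁ p₀.1).baseSet)
    (h₂ : p.2 ∈ (trivializationAt ℂ L₂ p₀.2).baseSet) (τ : ExtFiber L₁ L₂ p) :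
    extCoord L₁ L₂ p₀ p τ • (frame L₁ p₀.1 p.1 ⊗ₜ[ℂ] frame L₂ p₀.2 p.2) = τ := by
  induction τ using TensorProduct.induction_on with
  | zero => rw [map_zero, zero_smul]
  | add τ τ' h h' => rw [map_add, add_smul, h, h']
  | tmul u v =>
    conv_rhs => rw [← linearMapAt_smul_frame h₁ u, ← linearMapAt_smul_frame h₂ v,
      TensorProduct.smul_tmul_smul]
    rfl

theorem extCoord_self_eq_zero_iff {p : M₁ × M₂} {τ : ExtFiber L₁ L₂ p} :
    extCoord L₁ L₂ p p τ = 0 ↔ τ = 0 := by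
  refine ⟨fun h => ?_, fun h => by rw [h, map_zero]⟩
  rw [← extCoord_smul_frame_tmul_frame (mem_baseSet_trivializationAt ℂ L₁ p.1)
    (mem_baseSet_trivializationAt ℂ L₂ p.2) τ, h, zero_smul]

/-- A set-theoretic section which is holomorphic in the local trivializations, as an element of
`H⁰(M, L)`. -/
def QuantumSpace.ofCoord (K₁ : KahlerForm d₁ M₁) (h₁ : HermitianMetric d₁ L₁) (s : ∀ x, L₁ x)
    (hs : ∀ x₀, ContMDiffAt 𝓘(ℂ, Cn d₁) 𝓘(ℂ, ℂ) ω
      (fun x => (trivializationAt ℂ L₁ x₀).linearMapAt ℂ x (s x)) x₀) : QuantumSpace K₁ h₁ :=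
  (⟨s, fun x₀ => by
    refine (Bundle.contMDiffAt_section (IB := 𝓘(ℂ, Cn d₁)) (F := ℂ) (E := L₁) (n := ω) x₀).2
      ((hs x₀).congr_of_eventuallyEq ?_)
    filter_upwards [(trivializationAt ℂ L₁ x₀).open_baseSet.mem_nhds
      (mem_baseSet_trivializationAt ℂ L₁ x₀)] with x hx
    rw [Trivialization.coe_linearMapAt_of_mem _ hx]⟩ : Cₛ^ω⟮𝓘(ℂ, Cn d₁); ℂ, L₁⟯)

variable (L₁ L₂) in
/-- The trivialization at `x` of the first factor of `(L₁)_x ⊗ (L₂)_y`. -/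
def contractLeft (x : M₁) (y : M₂) : ExtFiber L₁ L₂ (x, y) →ₗ[ℂ] L₂ y :=
  TensorProduct.lid ℂ (L₂ y) ∘ₗ ((trivializationAt ℂ L₁ x).linearMapAt ℂ x).rTensor (L₂ y)

variable (L₁ L₂) in
/-- The trivialization at `y` of the second factor of `(L₁)_x ⊗ (L₂)_y`. -/
def contractRight (x : M₁) (y : M₂) : ExtFiber L₁ L₂ (x, y) →ₗ[ℂ] L₁ x :=
  TensorProduct.rid ℂ (L₁ x) ∘ₗ ((trivializationAt ℂ L₂ y).linearMapAt ℂ y).lTensor (L₁ x)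

/-- Makes slices holomorphic: the coordinate of a slice around `y₀` is the coordinate of the section
around `(x, y₀)`, restricted to `{x} × M₂`. -/
theorem linearMapAt_contractLeft (x : M₁) (y₀ y : M₂) (τ : ExtFiber L₁ L₂ (x, y)) :
    (trivializationAt ℂ L₂ y₀).linearMapAt ℂ y (contractLeft L₁ L₂ x y τ) =
      extCoord L₁ L₂ (x, y₀) (x, y) τ := by
  induction τ using TensorProduct.induction_on with
  | zero => simp only [map_zero]
  | add τ τ' h h' => simp only [map_add, h, h']
  | tmul u v => exact map_smul _ _ _

theorem linearMapAt_contractRight (x₀ x : M₁) (y : M₂) (τ : ExtFiber L₁ L₂ (x, y)) :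
    (trivializationAt ℂ L₁ x₀).linearMapAt ℂ x (contractRight L₁ L₂ x y τ) =
      extCoord L₁ L₂ (x₀, y) (x, y) τ := by
  induction τ using TensorProduct.induction_on with
  | zero => simp only [map_zero]
  | add τ τ' h h' => simp only [map_add, h, h']
  | tmul u v => exact (map_smul _ _ _).trans (mul_comm _ _)

/-- The restriction of a section of `L₁ ⊠ L₂` to `{x} × M₂`, as a section of `L₂`. -/
def sliceSnd (K₂ : KahlerForm d₂ M₂) (h₂ : HermitianMetric d₂ L₂) (x : M₁) :
    ExtSections d₁ d₂ L₁ L₂ →ₗ[ℂ] QuantumSpace K₂ h₂ where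
  toFun S := .ofCoord K₂ h₂ (fun y => contractLeft L₁ L₂ x y (S.1 (x, y))) fun y₀ => by
    simp only [linearMapAt_contractLeft]
    exact (S.2 (x, y₀)).comp y₀ (contMDiffAt_const.prodMk contMDiffAt_id)
  map_add' S T := DFunLike.ext _ _ fun y => (contractLeft L₁ L₂ x y).map_add _ _
  map_smul' c S := DFunLike.ext _ _ fun y => (contractLeft L₁ L₂ x y).map_smul _ _

/-- The restriction of a section of `L₁ ⊠ L₂` to `M₁ × {y}`, as a section of `L₁`. -/
def sliceFst (K₁ : KahlerForm d₁ M₁) (h₁ : HermitianMetric d₁ L₁) (y : M₂) :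
    ExtSections d₁ d₂ L₁ L₂ →ₗ[ℂ] QuantumSpace K₁ h₁ where
  toFun S := .ofCoord K₁ h₁ (fun x => contractRight L₁ L₂ x y (S.1 (x, y))) fun x₀ => by
    simp only [linearMapAt_contractRight]
    exact (S.2 (x₀, y)).comp x₀ (contMDiffAt_id.prodMk contMDiffAt_const)
  map_add' S T := DFunLike.ext _ _ fun x => (contractRight L₁ L₂ x y).map_add _ _
  map_smul' c S := DFunLike.ext _ _ fun x => (contractRight L₁ L₂ x y).map_smul _ _

/-- The bridge to linear algebra: evaluation on the product is the tensor product of the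
evaluations. Both sides are linear in `τ` and agree on pure tensors by definition. -/
theorem extCoord_kunneth (p : M₁ × M₂) (τ : QuantumSpace K₁ h₁ ⊗[ℂ] QuantumSpace K₂ h₂) :
    extCoord L₁ L₂ p p ((kunneth K₁ h₁ K₂ h₂ τ).1 p) = LinearMap.mul' ℂ ℂ
      (TensorProduct.map (QuantumSpace.evalAt K₁ h₁ p.1) (QuantumSpace.evalAt K₂ h₂ p.2) τ) := by
  induction τ using TensorProduct.induction_on with
  | zero => simp only [map_zero, Submodule.coe_zero, Pi.zero_apply]
  | add τ τ' h h' => simp only [map_add, Submodule.coe_add, Pi.add_apply, h, h']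
  | tmul s t => rfl

theorem bijective_kunneth [FiniteDimensional ℂ (QuantumSpace K₁ h₁)] :
    Function.Bijective (kunneth K₁ h₁ K₂ h₂) := by
  refine bijective_of_slices (ev₁ := QuantumSpace.evalAt K₁ h₁) (ev₂ := QuantumSpace.evalAt K₂ h₂)
    (ev := fun x y S => extCoord L₁ L₂ (x, y) (x, y) (S.1 (x, y))) (slice₂ := sliceSnd K₂ h₂)
    (slice₁ := sliceFst K₁ h₁)
    (fun s hs => DFunLike.ext _ _ fun x => QuantumSpace.evalAt_eq_zero_iff.1 (hs x))
    (fun t ht => DFunLike.ext _ _ fun y => QuantumSpace.evalAt_eq_zero_iff.1 (ht y))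
    (fun S T h => Subtype.ext (funext fun p => sub_eq_zero.1 (extCoord_self_eq_zero_iff.1 ?_)))
    (fun x y S => linearMapAt_contractLeft x y y _)
    (fun x y S => linearMapAt_contractRight x x y _)
    fun x y s t => extCoord_kunneth (x, y) (s ⊗ₜ t)
  rw [map_sub]
  exact sub_eq_zero.2 (h p.1 p.2)

/-- A section vanishes on a product set exactly when its tensor is killed by every product of an
evaluation on `Λ₁` with one on `Λ₂`, which is the situation of `eq_orthogonal_tensorSubspace`. -/
theorem comap_ker_restrictExtSections [CompactSpace M₁] [MeasurableSpace M₁]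
    [BorelSpace M₁] [CompactSpace M₂] [MeasurableSpace M₂] [BorelSpace M₂]
    [FiniteDimensional ℂ (QuantumSpace K₁ h₁)] [FiniteDimensional ℂ (QuantumSpace K₂ h₂)]
    (Λ₁ : Set M₁) (Λ₂ : Set M₂) :
    (LinearMap.ker (restrictExtSections d₁ d₂ L₁ L₂ (Λ₁ ×ˢ Λ₂))).comap (kunneth K₁ h₁ K₂ h₂) =
      (tensorSubspace (LinearMap.ker (restrictSections K₁ h₁ Λ₁))ᗮ
        (LinearMap.ker (restrictSections K₂ h₂ Λ₂))ᗮ)ᗮ := by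
  refine eq_orthogonal_tensorSubspace (f := fun x : Λ₁ => QuantumSpace.evalAt K₁ h₁ x)
    (g := fun y : Λ₂ => QuantumSpace.evalAt K₂ h₂ y) (fun s => ?_) (fun t => ?_) fun τ => ?_
  · simp only [QuantumSpace.evalAt_eq_zero_iff]
    exact funext_iff
  · simp only [QuantumSpace.evalAt_eq_zero_iff]
    exact funext_iff
  · have h : ∀ (x : Λ₁) (y : Λ₂), LinearMap.mul' ℂ ℂ (TensorProduct.map
        (QuantumSpace.evalAt K₁ h₁ x) (QuantumSpace.evalAt K₂ h₂ y) τ) = 0 ↔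
          (kunneth K₁ h₁ K₂ h₂ τ).1 (x, y) = 0 := fun x y => by
      rw [← extCoord_self_eq_zero_iff, extCoord_kunneth]
    simp only [h]
    exact ⟨fun hτ x y => congrFun hτ ⟨(x, y), x.2, y.2⟩,
      fun hτ => funext fun p => hτ ⟨p.1.1, p.2.1⟩ ⟨p.1.2, p.2.2⟩⟩

end ExternalTensorProduct

end KahlerQuantization

end

open KahlerQuantization in
theorem proposition3p4
    -- two compact connected complex manifolds of positive dimension
    {d₁ d₂ : ℕ} (hd₁ : 1 ≤ d₁) (hd₂ : 1 ≤ d₂)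
    {M₁ M₂ : Type*}
    [TopologicalSpace M₁] [T2Space M₁] [CompactSpace M₁] [ConnectedSpace M₁]
    [ChartedSpace (Cn d₁) M₁] [IsManifold 𝓘(ℂ, Cn d₁) ω M₁] [MeasurableSpace M₁] [BorelSpace M₁]
    [TopologicalSpace M₂] [T2Space M₂] [CompactSpace M₂] [ConnectedSpace M₂]
    [ChartedSpace (Cn d₂) M₂] [IsManifold 𝓘(ℂ, Cn d₂) ω M₂] [MeasurableSpace M₂] [BorelSpace M₂]
    -- holomorphic line bundles on them
    (L₁ : M₁ → Type*) [TopologicalSpace (TotalSpace ℂ L₁)] [∀ x, TopologicalSpace (L₁ x)]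
    [∀ x, AddCommGroup (L₁ x)] [∀ x, Module ℂ (L₁ x)] [FiberBundle ℂ L₁] [VectorBundle ℂ ℂ L₁]
    [ContMDiffVectorBundle ω ℂ L₁ 𝓘(ℂ, Cn d₁)]
    (L₂ : M₂ → Type*) [TopologicalSpace (TotalSpace ℂ L₂)] [∀ x, TopologicalSpace (L₂ x)]
    [∀ x, AddCommGroup (L₂ x)] [∀ x, Module ℂ (L₂ x)] [FiberBundle ℂ L₂] [VectorBundle ℂ ℂ L₂]
    [ContMDiffVectorBundle ω ℂ L₂ 𝓘(ℂ, Cn d₂)]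
    -- Kähler forms and Hermitian metrics satisfying the prequantum condition
    (K₁ : KahlerForm d₁ M₁) (K₂ : KahlerForm d₂ M₂)
    (h₁ : HermitianMetric d₁ L₁) (h₂ : HermitianMetric d₂ L₂)
    (hq₁ : IsPrequantum K₁ h₁) (hq₂ : IsPrequantum K₂ h₂)
    (hv₁ : IsVeryAmple d₁ L₁) (hv₂ : IsVeryAmple d₂ L₂)
    (Λ₁ : Set M₁) (Λ₂ : Set M₂) (hΛ₁ : Λ₁.Nonempty) (hΛ₂ : Λ₂.Nonempty) :
    -- `H_A ⊗ H_B` is identified with `H⁰(M₁ × M₂, L₁ ⊠ L₂)` by the canonical map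
    Function.Bijective (kunneth K₁ h₁ K₂ h₂) ∧
    -- under this identification, `ker R_{Λ₁ × Λ₂}` is the sum of the two subspaces
    (LinearMap.ker (restrictExtSections d₁ d₂ L₁ L₂ (Λ₁ ×ˢ Λ₂))).comap (kunneth K₁ h₁ K₂ h₂) =
      tensorSubspace ⊤ (LinearMap.ker (restrictSections K₂ h₂ Λ₂)) ⊔
        tensorSubspace (LinearMap.ker (restrictSections K₁ h₁ Λ₁))
          (LinearMap.ker (restrictSections K₂ h₂ Λ₂))ᗮ ∧
    -- and the sum is an (orthogonal) direct sum
    Disjoint (tensorSubspace ⊤ (LinearMap.ker (restrictSections K₂ h₂ Λ₂)))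
      (tensorSubspace (LinearMap.ker (restrictSections K₁ h₁ Λ₁))
        (LinearMap.ker (restrictSections K₂ h₂ Λ₂))ᗮ) ∧
    (tensorSubspace ⊤ (LinearMap.ker (restrictSections K₂ h₂ Λ₂))).IsOrtho
      (tensorSubspace (LinearMap.ker (restrictSections K₁ h₁ Λ₁))
        (LinearMap.ker (restrictSections K₂ h₂ Λ₂))ᗮ) ∧
    ((LinearMap.ker (restrictExtSections d₁ d₂ L₁ L₂ (Λ₁ ×ˢ Λ₂))).comap (kunneth K₁ h₁ K₂ h₂))ᗮ =
      tensorSubspace (LinearMap.ker (restrictSections K₁ h₁ Λ₁))ᗮ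
        (LinearMap.ker (restrictSections K₂ h₂ Λ₂))ᗮ := by
  have hker := comap_ker_restrictExtSections (K₁ := K₁) (h₁ := h₁) (K₂ := K₂) (h₂ := h₂) Λ₁ Λ₂
  have hortho := isOrtho_tensorSubspace_right (⊤ : Submodule ℂ (QuantumSpace K₁ h₁))
    (LinearMap.ker (restrictSections K₁ h₁ Λ₁))
    (LinearMap.ker (restrictSections K₂ h₂ Λ₂)).isOrtho_orthogonal_right
  refine ⟨bijective_kunneth, ?_, hortho.disjoint, hortho, ?_⟩
  -- Here `P` and `Q` are themselves complements of the two kernels, so `Pᗮ` and `Qᗮ` are the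
  -- kernels again.
  · rw [hker, orthogonal_tensorSubspace, Submodule.orthogonal_orthogonal,
      Submodule.orthogonal_orthogonal]
  · rw [hker, Submodule.orthogonal_orthogonal]
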